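/- Let $m,n\ge 0$ be integers, $d=m+n$, $D=\mathbb R^m_+\times\mathbb R^n$, and write $x=(x_I,x_J)\in\mathbb R^m\times\mathbb R^n$ for $x\in\mathbb R^d$, with $I=\{1,\dots,m\}$ and $J=\{m+1,\dots,d\}$. Let $h:\mathbb R^d\to\mathbb R^d$ be a truncation function (bounded, measurable, $h(\xi)=\xi$ near $0$). For $k=0,1,\dots,d$ let $\alpha_k\in\mathbb R^{d\times d}$, $\beta_k\in\mathbb R^d$ and let $\mu_k$ be a Borel measure on $D\setminus\{0\}$ such that the parameters are admissible (without killing), that is, with $\chi(x)=\min(1,|x|)$ for $x\in\mathbb R$: - for $k\in\{0\}\cup I$, $\alpha_k$ is symmetric positive semidefinite; $(\alpha_0)_{kl}=0$ for all $k,l\in I$; for $i\in I$, $(\alpha_i)_{kl}=0$ for all $k,l\in I$ with $(k,l)\neq(i,i)$; - $\int\bigl(\sum_{k\in I}\chi(\xi_k)+\sum_{j\in J}\chi(\xi_j)^2\bigr)\mu_0(d\xi)<\infty$, and $\int\bigl(\sum_{k\in I\setminus\{i\}}\chi(\xi_k)+\sum_{j\in J\cup\{i\}}\chi(\xi_j)^2\bigr)\mu_i(d\xi)<\infty$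 for $i\in I$; - $\beta_{0,k}-\int h_k\,d\mu_0\ge0$ for $k\in I$, and $\beta_{i,k}-\int h_k\,d\mu_i\ge0$ for $i,k\in I$, $k\ne i$, where $h_k$ and $\beta_{i,k}$ are the $k$-th components of $h$ and $\beta_i$; - for $j\in J$: $\alpha_j=0$, $\mu_j=0$, and $\beta_{j,k}=0$ for all $k\in I$. Set $\mathcal Y=\{y\in\mathbb R^d:\sum_{i=0}^m\int_{\{\xi\in D:|\xi|\ge1\}}e^{\langle y,\xi\rangle}\mu_i(d\xi)<\infty\}$, with interior $\mathcal Y^\circ$, and for $u\in\mathcal Y$ $$F(u)=\langle\alpha_0u,u\rangle+\langle\beta_0,u\rangle+\int_{D\setminus\{0\}}\bigl(e^{\langle u,\xi\rangle}-1-\langle u,h(\xi)\rangle\bigr)\mu_0(d\xi),$$ $$R_k(u)=\langle\alpha_ku,u\rangle+\langle\beta_k,u\rangle+\int_{D\setminus\{0\}}\bigl(e^{\langle u,\xi\rangle}-1-\langle u,h(\xi)\rangle\bigr)\mu_k(d\xi),\qquad k=1,\dots,d.$$ Fix $\Lambda\in\mathbb R^d$. For $(u,v)\in\mathcal Y^\circ\times\mathbb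 R$ let $(\Phi(\cdot,u,v),\Psi(\cdot,u,v))$ be the solution of $$\partial_s\Phi=F(\Psi),\quad\Phi(0,u,v)=0,\qquad \partial_s\Psi=R(\Psi)+v\Lambda,\quad\Psi(0,u,v)=u,$$ with $\Psi$ constrained to stay in $\mathcal Y^\circ$, let $T_+(u,v)\in[0,\infty]$ be its maximal lifetime, and for $t\ge0$ put $\mathcal Y_t=\{(u,v)\in\mathcal Y^\circ\times\mathbb R:T_+(u,v)>t\}$. Let $t\ge0$, $(u_1,v_1),(u_2,v_2)\in\mathcal Y_t$, $\lambda\in[0,1]$, and $(u_\lambda,v_\lambda)=\lambda(u_1,v_1)+(1-\lambda)(u_2,v_2)$. Then $(u_\lambda,v_\lambda)\in\mathcal Y_t$, so that $\Psi(s,u_\lambda,v_\lambda)$ is well defined for $s\in[0,t]$, and $$\Psi_I(s,u_\lambda,v_\lambda)\preceq\lambda\,\Psi_I(s,u_1,v_1)+(1-\lambda)\,\Psi_I(s,u_2,v_2)\qquad\text{for all }s\in[0,t],$$ where $\preceq$ is the componentwise order on $\mathbb R^m$. -/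

import Mathlib

namespace AffineRiccati

open scoped Matrix

/-- The Euclidean space `ℝ^d = ℝ^m × ℝ^n`, `d = m + n`. The coordinates `Sum.inl i` form the block
`I` (first `m` coordinates), the coordinates `Sum.inr j` the block `J` (last `n` coordinates). -/
abbrev Vec (m n : ℕ) : Type := EuclideanSpace ℝ (Fin m ⊕ Fin n)

/-- The state space `D = ℝ^m_+ × ℝ^n`. -/
def stateSpace (m n : ℕ) : Set (Vec m n) := {ξ | ∀ i : Fin m, 0 ≤ ξ (Sum.inl i)}

/-- Truncation functions: bounded, measurable, equal to the identity near the origin. -/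
structure IsTruncation {m n : ℕ} (h : Vec m n → Vec m n) : Prop where
  measurable : Measurable h
  bounded : ∃ C : ℝ, ∀ ξ, ‖h ξ‖ ≤ C
  eq_self_near_zero : ∃ ε > (0 : ℝ), ∀ ξ, ‖ξ‖ < ε → h ξ = ξ

/-- Data entering the functional characteristics: the truncation function `h`, and for each of the
indices `0` and `1, …, d` a matrix, a vector and a measure. The index `0` is separate, the indices
`1, …, d` are the elements of `Fin m ⊕ Fin n`. -/
structure Params (m n : ℕ) where
  h : Vec m n → Vec m n
  α₀ : Matrix (Fin m ⊕ Fin n) (Fin m ⊕ Fin n) ℝ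
  β₀ : Vec m n
  μ₀ : MeasureTheory.Measure (Vec m n)
  α : Fin m ⊕ Fin n → Matrix (Fin m ⊕ Fin n) (Fin m ⊕ Fin n) ℝ
  β : Fin m ⊕ Fin n → Vec m n
  μ : Fin m ⊕ Fin n → MeasureTheory.Measure (Vec m n)

/-- The admissibility conditions on `ℝ^m_+ × ℝ^n` of Duffie, Filipović and Schachermayer, without
killing. Since all the coordinates of a jump are compensated by `h` in the functional
characteristics, the conditions on the inward drift, which are usually stated for the
uncompensated coordinates, are conditions on `β k - ∫ h_k dμ`. -/
structure Params.IsAdmissible {m n : ℕ} (P : Params m n) : Prop where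
  truncation : IsTruncation P.h
  /-- The measures live on `D ∖ {0}`. -/
  μ₀_supp : P.μ₀ (stateSpace m n \ {0})ᶜ = 0
  μ_supp : ∀ k, P.μ k (stateSpace m n \ {0})ᶜ = 0
  /-- `α₀` is symmetric positive semidefinite with vanishing block `II`. -/
  α₀_psd : P.α₀.PosSemidef
  α₀_II : ∀ k l : Fin m, P.α₀ (Sum.inl k) (Sum.inl l) = 0
  /-- `αᵢ`, `i ∈ I`, is symmetric positive semidefinite and its block `II` vanishes outside of the
  entry `(i, i)`. -/
  α_psd : ∀ i : Fin m, (P.α (Sum.inl i)).PosSemidef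
  α_II : ∀ i k l : Fin m, ¬ (k = i ∧ l = i) → P.α (Sum.inl i) (Sum.inl k) (Sum.inl l) = 0
  /-- Integrability of `μ₀`: first order in `I`, second order in `J`. -/
  μ₀_moment : ∫⁻ ξ, ENNReal.ofReal
      ((∑ k : Fin m, min 1 |ξ (Sum.inl k)|) + ∑ j : Fin n, (min 1 |ξ (Sum.inr j)|) ^ 2) ∂P.μ₀ < ⊤
  /-- Integrability of `μᵢ`, `i ∈ I`: first order in `I ∖ {i}`, second order in `J ∪ {i}`. -/
  μ_moment : ∀ i : Fin m, ∫⁻ ξ, ENNReal.ofReal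
      ((∑ k ∈ Finset.univ.erase i, min 1 |ξ (Sum.inl k)|) + (min 1 |ξ (Sum.inl i)|) ^ 2
        + ∑ j : Fin n, (min 1 |ξ (Sum.inr j)|) ^ 2) ∂P.μ (Sum.inl i) < ⊤
  /-- Inward drift. -/
  β₀_I : ∀ k : Fin m, 0 ≤ P.β₀ (Sum.inl k) - ∫ ξ, P.h ξ (Sum.inl k) ∂P.μ₀
  β_I : ∀ i k : Fin m, k ≠ i →
    0 ≤ P.β (Sum.inl i) (Sum.inl k) - ∫ ξ, P.h ξ (Sum.inl k) ∂P.μ (Sum.inl i)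
  /-- For `j ∈ J` there is neither diffusion nor jumps, and `βⱼ` has no component in `I`. -/
  α_J : ∀ j : Fin n, P.α (Sum.inr j) = 0
  μ_J : ∀ j : Fin n, P.μ (Sum.inr j) = 0
  β_J : ∀ (j : Fin n) (k : Fin m), P.β (Sum.inr j) (Sum.inl k) = 0

/-- `⟨a u, u⟩ + ⟨b, u⟩ + ∫_{D ∖ {0}} (e^{⟨u, ξ⟩} - 1 - ⟨u, h(ξ)⟩) ν(dξ)`. -/
noncomputable def levyKhintchine {m n : ℕ} (h : Vec m n → Vec m n)
    (a : Matrix (Fin m ⊕ Fin n) (Fin m ⊕ Fin n) ℝ) (b : Vec m n)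
    (ν : MeasureTheory.Measure (Vec m n)) (u : Vec m n) : ℝ :=
  (a *ᵥ u.ofLp) ⬝ᵥ u.ofLp + inner ℝ b u
    + ∫ ξ in stateSpace m n \ {0}, (Real.exp (inner ℝ u ξ) - 1 - inner ℝ u (h ξ)) ∂ν

/-- The functional characteristic `F`, at real arguments. -/
noncomputable def Params.F {m n : ℕ} (P : Params m n) (u : Vec m n) : ℝ :=
  levyKhintchine P.h P.α₀ P.β₀ P.μ₀ u

/-- The functional characteristic `R = (R₁, …, R_d)`, at real arguments. -/
noncomputable def Params.R {m n : ℕ} (P : Params m n) (u : Vec m n) : Vec m n :=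
  WithLp.toLp 2 fun k => levyKhintchine P.h (P.α k) (P.β k) (P.μ k) u

/-- The effective real domain `𝒴` of `F` and `R`: exponential moments of the large jumps. -/
def Params.Y {m n : ℕ} (P : Params m n) : Set (Vec m n) :=
  {y | (∫⁻ ξ in {ξ | ξ ∈ stateSpace m n ∧ 1 ≤ ‖ξ‖}, ENNReal.ofReal (Real.exp (inner ℝ y ξ)) ∂P.μ₀)
      + ∑ i : Fin m, ∫⁻ ξ in {ξ | ξ ∈ stateSpace m n ∧ 1 ≤ ‖ξ‖},
          ENNReal.ofReal (Real.exp (inner ℝ y ξ)) ∂P.μ (Sum.inl i) < ⊤}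

/-- `(φ, ψ)` solves on `[0, T]` the generalized Riccati system
`φ' = F(ψ)`, `φ(0) = 0`, `ψ' = R(ψ) + v Λ`, `ψ(0) = u`, with `ψ` inside the interior of `𝒴`. -/
structure IsRiccatiSolution {m n : ℕ} (P : Params m n) (Λ : Vec m n) (u : Vec m n) (v T : ℝ)
    (φ : ℝ → ℝ) (ψ : ℝ → Vec m n) : Prop where
  φ_zero : φ 0 = 0
  ψ_zero : ψ 0 = u
  mem_interior : ∀ t ∈ Set.Icc 0 T, ψ t ∈ interior P.Y
  φ_deriv : ∀ t ∈ Set.Icc 0 T, HasDerivWithinAt φ (P.F (ψ t)) (Set.Icc 0 T) t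
  ψ_deriv : ∀ t ∈ Set.Icc 0 T, HasDerivWithinAt ψ (P.R (ψ t) + v • Λ) (Set.Icc 0 T) t

/-- The maximal lifetime `T₊(u, v) ∈ [0, ∞]` of the solution inside the interior of `𝒴`. -/
noncomputable def lifetime {m n : ℕ} (P : Params m n) (Λ : Vec m n) (u : Vec m n) (v : ℝ) :
    ENNReal :=
  sSup {τ | ∃ T : ℝ, 0 ≤ T ∧ τ = ENNReal.ofReal T ∧ ∃ φ ψ, IsRiccatiSolution P Λ u v T φ ψ}

/-- The set `𝒴_t` of the real initial data `(u, v)` with `u` in the interior of `𝒴` and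
`T₊(u, v) > t`. -/
def Yt {m n : ℕ} (P : Params m n) (Λ : Vec m n) (t : ℝ) : Set (Vec m n × ℝ) :=
  {p | p.1 ∈ interior P.Y ∧ ENNReal.ofReal t < lifetime P Λ p.1 p.2}

open Classical in
/-- `Ψ(s, u, v)`: the value at time `s` of the `ψ`-component of the solution on `[0, s]` (with
value `0` if there is no solution on `[0, s]`). -/
noncomputable def Psi {m n : ℕ} (P : Params m n) (Λ : Vec m n) (s : ℝ) (u : Vec m n) (v : ℝ) :
    Vec m n :=
  if H : ∃ p : (ℝ → ℝ) × (ℝ → Vec m n), IsRiccatiSolution P Λ u v s p.1 p.2 then H.choose.2 s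
  else 0

/-- The first `m` components `Ψ_I(s, u, v)`. Inequality in `Fin m → ℝ` is componentwise. -/
noncomputable def PsiI {m n : ℕ} (P : Params m n) (Λ : Vec m n) (s : ℝ) (u : Vec m n) (v : ℝ) :
    Fin m → ℝ :=
  fun i => Psi P Λ s u v (Sum.inl i)

end AffineRiccati

/-! Let `z` be the convex combination of the two given solutions. For `i ∈ I`, `R_i` is convex,
being a positive semidefinite form plus a linear term plus an integral of convex functions of `u`,
so `z_i' ≥ R_i(z) + v_λ Λ_i`. For `j ∈ J`, `R_j` is linear and involves only the coordinates in `J`,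
so `z_J` satisfies its equation exactly. Hence `z` is a supersolution with initial value `u_λ`.
Admissibility makes `R` quasi-monotone: raising coordinates of `I` other than `i` does not lower
`R_i`.

Comparison alone would bound `Ψ_I` only while `Ψ` exists, so survival has to be proved as well.
Below `z` there are two ways to fail. Leaving `𝒴°` is impossible because `𝒴°` is stable under
lowering coordinates in `I` (jumps have nonnegative `I`-part). Explosion to `-∞` is impossible
because `R_i` has a lower bound of linear growth on `𝒴`.

`exists_solution_le_supersolution` settles existence and comparison together: the field is cut off
between a lower barrier and `z`, solved on all of `[0, T]`, and the cutoff is shown never to act.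
Uniqueness, from the local Lipschitz property of convex functions, identifies the result with `Psi`.
-/

namespace AffineRiccati

open Set Filter Topology MeasureTheory
open scoped NNReal Matrix

/-- A function that does not increase where it is positive stays nonpositive. -/
theorem nonpos_of_deriv_nonpos_of_pos {g g' : ℝ → ℝ} {a b : ℝ}
    (hg : ∀ t ∈ Icc a b, HasDerivWithinAt g (g' t) (Icc a b) t) (ha : g a ≤ 0)
    (hg' : ∀ t ∈ Icc a b, 0 < g t → g' t ≤ 0) : ∀ t ∈ Icc a b, g t ≤ 0 := by
  intro t ht
  refine le_of_forall_pos_le_add fun ε hε => ?_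
  have hpos : 0 < 1 + (t - a) := by linarith [ht.1]
  -- The barrier is a line that is positive on the interval, has positive slope and equals `ε` at
  -- `t`. At a contact point `g > 0`, so `g' ≤ 0` is below the slope and `g` cannot cross.
  have key : ∀ ⦃x⦄, x ∈ Icc a b → g x ≤ ε / (1 + (t - a)) * (1 + (x - a)) := by
    refine image_le_of_deriv_right_lt_deriv_boundary (f' := g')
      (B' := fun _ => ε / (1 + (t - a))) (fun x hx => (hg x hx).continuousWithinAt)
      (fun x hx => (hg x (Ico_subset_Icc_self hx)).mono_of_mem_nhdsWithin
        (Icc_mem_nhdsGE_of_mem hx)) ?_ (fun x => ?_) fun x hx hgx => ?_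
    · have : 0 < ε / (1 + (t - a)) := by positivity
      simp only [sub_self, add_zero, mul_one]
      linarith
    · simpa using ((((hasDerivAt_id x).sub_const a).const_add 1).const_mul (ε / (1 + (t - a))))
    · have h1 : 0 < ε / (1 + (t - a)) := by positivity
      refine (hg' x (Ico_subset_Icc_self hx) ?_).trans_lt h1
      rw [hgx]
      have : 0 < 1 + (x - a) := by linarith [hx.1]
      positivity
  have := key ht
  rw [div_mul_cancel₀ _ hpos.ne'] at this
  linarith

/-! ### Coordinates and norms -/

variable {m n : ℕ}

theorem continuousOn_vec {X : Type*} [TopologicalSpace X] {f : X → Vec m n} {s : Set X}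
    (hf : ∀ k, ContinuousOn (fun x => f x k) s) : ContinuousOn f s :=
  (PiLp.continuous_toLp 2 _).comp_continuousOn (continuousOn_pi.2 hf)

theorem norm_le_of_abs_le {x y : Vec m n} (h : ∀ k, |x k| ≤ |y k|) : ‖x‖ ≤ ‖y‖ := by
  rw [EuclideanSpace.norm_eq, EuclideanSpace.norm_eq]
  gcongr with k
  exact h k

theorem norm_le_sum_abs (x : Vec m n) : ‖x‖ ≤ ∑ k, |x k| := by
  rw [EuclideanSpace.norm_eq]
  refine Real.sqrt_le_iff.2 ⟨by positivity, ?_⟩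
  simpa using Finset.sum_sq_le_sq_sum_of_nonneg (s := Finset.univ) (f := fun k => |x k|)
    fun k _ => abs_nonneg _

theorem abs_apply_le (x : Vec m n) (k) : |x k| ≤ ‖x‖ := PiLp.norm_apply_le x k

theorem hasDerivWithinAt_apply {f : ℝ → Vec m n} {f' : Vec m n} {s : Set ℝ} {t : ℝ}
    (hf : HasDerivWithinAt f f' s t) (k) : HasDerivWithinAt (fun t => f t k) (f' k) s t :=
  (EuclideanSpace.proj (𝕜 := ℝ) k).hasFDerivAt.comp_hasDerivWithinAt t hf

theorem exists_lipschitzOnWith_of_apply {G : Vec m n → Vec m n} {S : Set (Vec m n)}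
    (hS : IsCompact S) (hG : ∀ k, LocallyLipschitzOn S fun y => G y k) :
    ∃ K, LipschitzOnWith K G S := by
  choose K hK using fun k => (hG k).exists_lipschitzOnWith_of_compact hS
  refine ⟨∑ k, K k, LipschitzOnWith.of_dist_le_mul fun x hx y hy => ?_⟩
  rw [dist_eq_norm]
  refine (norm_le_sum_abs _).trans ?_
  rw [NNReal.coe_sum, Finset.sum_mul]
  exact Finset.sum_le_sum fun k _ => (hK k).dist_le_mul x hx y hy

/-! ### Cutoff and comparison for quasi-monotone systems -/

/-- The coordinates in `I` are cut off from above at `b` and from below at `-l`, the coordinates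
in `J` are replaced by those of `b`. -/
noncomputable def cutoff (l : ℝ) (b y : Vec m n) : Vec m n :=
  WithLp.toLp 2 (Sum.elim (fun i => max (-l) (min (y (Sum.inl i)) (b (Sum.inl i))))
    fun j => b (Sum.inr j))

@[simp] theorem cutoff_inl (l : ℝ) (b y : Vec m n) (i : Fin m) :
    cutoff l b y (Sum.inl i) = max (-l) (min (y (Sum.inl i)) (b (Sum.inl i))) := rfl

@[simp] theorem cutoff_inr (l : ℝ) (b y : Vec m n) (j : Fin n) :
    cutoff l b y (Sum.inr j) = b (Sum.inr j) := rfl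

theorem lipschitzWith_cutoff (l : ℝ) (b : Vec m n) : LipschitzWith 1 (cutoff l b) := by
  refine LipschitzWith.of_dist_le_mul fun x y => ?_
  rw [NNReal.coe_one, one_mul, dist_eq_norm, dist_eq_norm]
  refine norm_le_of_abs_le ?_
  rintro (i | j)
  · simp only [PiLp.sub_apply, cutoff_inl]
    refine (abs_max_sub_max_le_max _ _ _ _).trans (max_le (by simp) ?_)
    exact (abs_min_sub_min_le_max _ _ _ _).trans (max_le le_rfl (by simp))
  · simp

theorem cutoff_inl_le {l : ℝ} {b : Vec m n} {i : Fin m} (h : -l ≤ b (Sum.inl i)) (y : Vec m n) :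
    cutoff l b y (Sum.inl i) ≤ b (Sum.inl i) :=
  max_le h (min_le_right _ _)

theorem norm_cutoff_le {l M : ℝ} {b : Vec m n} (hb : ‖b‖ ≤ M) (hM : M ≤ l) (y : Vec m n) :
    ‖cutoff l b y‖ ≤ (m + n : ℕ) * l := by
  refine (norm_le_sum_abs _).trans ?_
  have : ∀ k ∈ Finset.univ, |cutoff l b y k| ≤ l := by
    intro k _
    have hk := abs_le.1 (((abs_apply_le b k).trans hb).trans hM)
    rcases k with i | j
    · exact abs_le.2 ⟨le_max_left _ _, (cutoff_inl_le hk.1 y).trans hk.2⟩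
    · exact abs_le.2 hk
  simpa using Finset.sum_le_card_nsmul _ _ _ this

/-- Global existence for a quasi-monotone vector field below a supersolution. -/
theorem exists_solution_le_supersolution {U : Set (Vec m n)} {G : Vec m n → Vec m n}
    (hU : ∀ y ∈ U, ∀ x, (∀ i, x (Sum.inl i) ≤ y (Sum.inl i)) →
      (∀ j, x (Sum.inr j) = y (Sum.inr j)) → x ∈ U)
    (hlip : ∀ k, LocallyLipschitzOn U fun y => G y k)
    (hmono : ∀ y ∈ U, ∀ x, (∀ i, x (Sum.inl i) ≤ y (Sum.inl i)) →
      (∀ j, x (Sum.inr j) = y (Sum.inr j)) → ∀ i, x (Sum.inl i) = y (Sum.inl i) →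
      G x (Sum.inl i) ≤ G y (Sum.inl i))
    (hJ : ∀ x y, (∀ j, x (Sum.inr j) = y (Sum.inr j)) → ∀ j, G x (Sum.inr j) = G y (Sum.inr j))
    {C : ℝ} (hC : 0 ≤ C) (hlow : ∀ y ∈ U, ∀ i, -(C * (1 + ‖y‖)) ≤ G y (Sum.inl i))
    {T : ℝ} (hT : 0 ≤ T) {z z' : ℝ → Vec m n} (hzU : ∀ t ∈ Icc 0 T, z t ∈ U)
    (hz : ∀ t ∈ Icc 0 T, HasDerivWithinAt z (z' t) (Icc 0 T) t)
    (hzI : ∀ t ∈ Icc 0 T, ∀ i, G (z t) (Sum.inl i) ≤ z' t (Sum.inl i))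
    (hzJ : ∀ t ∈ Icc 0 T, ∀ j, z' t (Sum.inr j) = G (z t) (Sum.inr j)) :
    ∃ y : ℝ → Vec m n, y 0 = z 0 ∧ ∀ t ∈ Icc 0 T, y t ∈ U ∧
      HasDerivWithinAt y (G (y t)) (Icc 0 T) t ∧ (∀ i, y t (Sum.inl i) ≤ z t (Sum.inl i)) ∧
      ∀ j, y t (Sum.inr j) = z t (Sum.inr j) := by
  have hzc : ContinuousOn z (Icc 0 T) := fun t ht => (hz t ht).continuousWithinAt
  have hz_apply : ∀ k, ContinuousOn (fun t => z t k) (Icc 0 T) := fun k t ht =>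
    (hasDerivWithinAt_apply (hz t ht) k).continuousWithinAt
  obtain ⟨M, hM⟩ := isCompact_Icc.exists_bound_of_continuousOn hzc
  have h0 : (0 : ℝ) ∈ Icc 0 T := left_mem_Icc.2 hT
  have hM0 : 0 ≤ M := (norm_nonneg _).trans (hM 0 h0)
  set N : ℝ := ((m + n : ℕ) : ℝ) with hN
  have hN0 : 0 ≤ N := Nat.cast_nonneg _
  set B := C * (1 + N) with hB
  have hB0 : 0 ≤ B := by positivity
  -- `-l` is the lower barrier. Cut-off points have norm at most `N * l` and `1 ≤ l`, so the field
  -- there is at least `-C * (1 + N) * l = -l'`.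
  set l : ℝ → ℝ := fun t => (M + 1) * Real.exp (B * t) with hl
  have hl_deriv : ∀ t, HasDerivAt l (B * l t) t := fun t => by
    have := (((hasDerivAt_id t).const_mul B).exp).const_mul (M + 1)
    simp only [id, mul_one] at this
    convert! this using 1
    simp only [hl]; ring
  have hlM : ∀ t ∈ Icc 0 T, M + 1 ≤ l t := fun t ht =>
    le_mul_of_one_le_right (by linarith) (Real.one_le_exp (mul_nonneg hB0 ht.1))
  have hlc : Continuous l := by fun_prop
  have hlz : ∀ t ∈ Icc 0 T, ∀ k, -l t ≤ z t k := fun t ht k => by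
    have := (abs_le.1 ((abs_apply_le (z t) k).trans (hM t ht))).1
    linarith [hlM t ht]
  set c : ℝ → Vec m n → Vec m n := fun t y => cutoff (l t) (z t) y with hc
  have hcU : ∀ t ∈ Icc 0 T, ∀ y, c t y ∈ U := fun t ht y =>
    hU _ (hzU t ht) _ (fun i => cutoff_inl_le (hlz t ht _) y) fun j => rfl
  -- the compact set in which the cut off field is evaluated
  obtain ⟨S, hS, hSU, hcS⟩ : ∃ S, IsCompact S ∧ S ⊆ U ∧ ∀ t ∈ Icc 0 T, ∀ y, c t y ∈ S := by
    have hcj : ContinuousOn (fun p : ℝ × Vec m n => c p.1 p.2)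
        (Icc 0 T ×ˢ Metric.closedBall (0 : Vec m n) (N * l T)) := by
      have hzp : ∀ k, ContinuousOn (fun p : ℝ × Vec m n => z p.1 k)
          (Icc 0 T ×ˢ Metric.closedBall (0 : Vec m n) (N * l T)) := fun k =>
        (hz_apply k).comp continuousOn_fst fun p hp => hp.1
      refine continuousOn_vec ?_
      rintro (i | j)
      · refine ContinuousOn.sup (by fun_prop) (ContinuousOn.inf ?_ (hzp _))
        exact ((EuclideanSpace.proj (𝕜 := ℝ) (Sum.inl i : Fin m ⊕ Fin n)).continuous.comp
          continuous_snd).continuousOn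
      · exact hzp _
    refine ⟨_, (isCompact_Icc.prod (isCompact_closedBall _ _)).image_of_continuousOn hcj, ?_, ?_⟩
    · rintro _ ⟨⟨t, y⟩, ⟨ht, -⟩, rfl⟩
      exact hcU t ht y
    · intro t ht y
      -- The cutoff is idempotent, so every value is already attained on the ball of radius `N * l
      -- T`.
      refine ⟨(t, c t y), ⟨ht, mem_closedBall_zero_iff.2 ?_⟩, ?_⟩
      · refine (norm_cutoff_le (hM t ht) (by linarith [hlM t ht]) y).trans ?_
        refine mul_le_mul_of_nonneg_left ?_ hN0
        simp only [hl]
        gcongr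
        exact ht.2
      · ext k
        rcases k with i | j
        · have := hlz t ht (Sum.inl i)
          simp only [hc, cutoff_inl]
          rw [min_eq_left (max_le this (min_le_right _ _)), max_eq_right (le_max_left _ _)]
        · rfl
  obtain ⟨K, hK⟩ := exists_lipschitzOnWith_of_apply hS fun k => (hlip k).mono hSU
  obtain ⟨L, hL⟩ := hS.exists_bound_of_continuousOn hK.continuousOn
  have hL' : ∀ x ∈ S, ‖G x‖ ≤ L.toNNReal := fun x hx =>
    (hL x hx).trans (Real.le_coe_toNNReal L)
  -- The cut-off field is bounded by `L` everywhere, so the ball of radius `L * T` is never left and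
  -- the solution covers all of `[0, T]`.
  have hPL : IsPicardLindelof (fun t y => G (c t y)) (⟨0, h0⟩ : Icc (0 : ℝ) T) (z 0)
      (L.toNNReal * T.toNNReal) 0 L.toNNReal K := by
    refine ⟨fun t ht => ?_, fun y _ => ?_, fun t ht y _ => hL' _ (hcS t ht y), ?_⟩
    · have := hK.comp ((lipschitzWith_cutoff (l t) (z t)).lipschitzOnWith
        (s := Metric.closedBall (z 0) (L.toNNReal * T.toNNReal : ℝ≥0))) fun y _ => hcS t ht y
      rwa [mul_one] at this
    · refine hK.continuousOn.comp (continuousOn_vec ?_) fun t ht => hcS t ht y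
      rintro (i | j)
      · exact ContinuousOn.sup (by fun_prop) (ContinuousOn.inf continuousOn_const (hz_apply _))
      · exact hz_apply _
    · simp [hT]
  obtain ⟨y, hy0, hy⟩ := hPL.exists_eq_forall_mem_Icc_hasDerivWithinAt₀
  have hcle : ∀ t ∈ Icc 0 T, ∀ i, c t (y t) (Sum.inl i) ≤ z t (Sum.inl i) := fun t ht i =>
    cutoff_inl_le (hlz t ht _) _
  have hyJ : ∀ t ∈ Icc 0 T, ∀ j, y t (Sum.inr j) = z t (Sum.inr j) := by
    have hd : ∀ t ∈ Icc 0 T, ∀ j, G (c t (y t)) (Sum.inr j) = z' t (Sum.inr j) := fun t ht j =>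
      (hJ (c t (y t)) (z t) (fun _ => rfl) j).trans (hzJ t ht j).symm
    intro t ht j
    refine le_antisymm (sub_nonpos.1 ?_) (sub_nonpos.1 ?_)
    · refine nonpos_of_deriv_nonpos_of_pos (fun t ht => (hasDerivWithinAt_apply (hy t ht)
        (Sum.inr j)).sub (hasDerivWithinAt_apply (hz t ht) (Sum.inr j))) ?_ ?_ t ht
      · simp [hy0]
      · intro t ht _
        rw [hd t ht, sub_self]
    · refine nonpos_of_deriv_nonpos_of_pos (fun t ht => (hasDerivWithinAt_apply (hz t ht)
        (Sum.inr j)).sub (hasDerivWithinAt_apply (hy t ht) (Sum.inr j))) ?_ ?_ t ht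
      · simp [hy0]
      · intro t ht _
        rw [hd t ht, sub_self]
  -- Where `y_i > z_i`, the cutoff resets coordinate `i` to `z_i` and keeps the others below `z`, so
  -- quasi-monotonicity gives `y_i' ≤ G_i(z) ≤ z_i'`.
  have hyI : ∀ t ∈ Icc 0 T, ∀ i, y t (Sum.inl i) ≤ z t (Sum.inl i) := by
    intro t ht i
    refine sub_nonpos.1 (nonpos_of_deriv_nonpos_of_pos (fun t ht => (hasDerivWithinAt_apply
      (hy t ht) (Sum.inl i)).sub (hasDerivWithinAt_apply (hz t ht) (Sum.inl i))) ?_ ?_ t ht)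
    · simp [hy0]
    · intro t ht hpos
      refine sub_nonpos.2 (le_trans ?_ (hzI t ht i))
      refine hmono _ (hzU t ht) _ (hcle t ht) (fun _ => rfl) i ?_
      simp only [hc, cutoff_inl]
      rw [min_eq_right (sub_pos.1 hpos).le, max_eq_right (hlz t ht _)]
  have hyl : ∀ t ∈ Icc 0 T, ∀ i, -l t ≤ y t (Sum.inl i) := by
    intro t ht i
    suffices -l t - y t (Sum.inl i) ≤ 0 by linarith
    refine nonpos_of_deriv_nonpos_of_pos (fun t ht => ((hl_deriv t).hasDerivWithinAt.neg).sub
      (hasDerivWithinAt_apply (hy t ht) (Sum.inl i))) ?_ ?_ t ht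
    · have h1 := hlz 0 h0 (Sum.inl i)
      rw [← hy0] at h1
      exact sub_nonpos.2 h1
    · intro t ht _
      have h1 := hlow _ (hcU t ht (y t)) i
      have h2 : ‖c t (y t)‖ ≤ N * l t :=
        norm_cutoff_le (hM t ht) (by linarith [hlM t ht]) (y t)
      have h3 : C * (1 + ‖c t (y t)‖) ≤ C * (l t + N * l t) := by
        gcongr
        linarith [hlM t ht]
      have h4 : B * l t = C * (l t + N * l t) := by rw [hB]; ring
      linarith
  have hcy : ∀ t ∈ Icc 0 T, c t (y t) = y t := by
    intro t ht
    ext k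
    rcases k with i | j
    · simp only [hc, cutoff_inl]
      rw [min_eq_left (hyI t ht i), max_eq_right (hyl t ht i)]
    · exact (hyJ t ht j).symm
  refine ⟨y, hy0, fun t ht => ⟨?_, ?_, hyI t ht, hyJ t ht⟩⟩
  · rw [← hcy t ht]
    exact hcU t ht _
  · have := hy t ht
    rwa [hcy t ht] at this

/-- Solutions of an autonomous equation with a locally Lipschitz field are unique. -/
theorem eqOn_of_hasDerivWithinAt {U : Set (Vec m n)} {G : Vec m n → Vec m n}
    (hlip : ∀ k, LocallyLipschitzOn U fun y => G y k) {T : ℝ} {x y : ℝ → Vec m n}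
    (hxU : ∀ t ∈ Icc 0 T, x t ∈ U) (hyU : ∀ t ∈ Icc 0 T, y t ∈ U)
    (hx : ∀ t ∈ Icc 0 T, HasDerivWithinAt x (G (x t)) (Icc 0 T) t)
    (hy : ∀ t ∈ Icc 0 T, HasDerivWithinAt y (G (y t)) (Icc 0 T) t) (h0 : x 0 = y 0) :
    EqOn x y (Icc 0 T) := by
  have hxc : ContinuousOn x (Icc 0 T) := fun t ht => (hx t ht).continuousWithinAt
  have hyc : ContinuousOn y (Icc 0 T) := fun t ht => (hy t ht).continuousWithinAt
  have hS := (isCompact_Icc.image_of_continuousOn hxc).union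
    (isCompact_Icc.image_of_continuousOn hyc)
  have hSU : x '' Icc 0 T ∪ y '' Icc 0 T ⊆ U :=
    union_subset (image_subset_iff.2 hxU) (image_subset_iff.2 hyU)
  obtain ⟨K, hK⟩ := exists_lipschitzOnWith_of_apply hS fun k => (hlip k).mono hSU
  exact ODE_solution_unique_of_mem_Icc_right (v := fun _ => G) (fun _ _ => hK) hxc
    (fun t ht => (hx t (Ico_subset_Icc_self ht)).mono_of_mem_nhdsWithin
      (Icc_mem_nhdsGE_of_mem ht))
    (fun t ht => Or.inl (mem_image_of_mem _ (Ico_subset_Icc_self ht))) hyc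
    (fun t ht => (hy t (Ico_subset_Icc_self ht)).mono_of_mem_nhdsWithin
      (Icc_mem_nhdsGE_of_mem ht))
    (fun t ht => Or.inr (mem_image_of_mem _ (Ico_subset_Icc_self ht))) h0

/-! ### Inner products, the state space and quadratic forms -/

theorem inner_eq_sum (x y : Vec m n) : inner ℝ x y = ∑ k, x k * y k := by
  simp [PiLp.inner_apply, mul_comm]

theorem measurableSet_stateSpace : MeasurableSet (stateSpace m n) := by
  have : stateSpace m n = ⋂ i : Fin m, {ξ | 0 ≤ ξ (Sum.inl i)} := by
    ext; simp [stateSpace]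
  rw [this]
  exact MeasurableSet.iInter fun i => measurableSet_le measurable_const (by fun_prop)

section Quadratic

variable {ι : Type*} [Fintype ι] {a : Matrix ι ι ℝ}

/-- The gap between the two sides is `p * q` times the form at `x - y`. -/
theorem quadraticForm_convexOn (ha : a.PosSemidef) (x y : ι → ℝ) {p q : ℝ} (hp : 0 ≤ p)
    (hq : 0 ≤ q) (hpq : p + q = 1) :
    (a *ᵥ (p • x + q • y)) ⬝ᵥ (p • x + q • y) ≤ p * ((a *ᵥ x) ⬝ᵥ x) + q * ((a *ᵥ y) ⬝ᵥ y) := by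
  have h := ha.dotProduct_mulVec_nonneg (x - y)
  rw [star_trivial, dotProduct_comm] at h
  simp only [Matrix.mulVec_sub, dotProduct_sub, sub_dotProduct] at h
  simp only [Matrix.mulVec_add, Matrix.mulVec_smul, dotProduct_add, add_dotProduct,
    smul_dotProduct, dotProduct_smul, smul_eq_mul]
  obtain rfl : q = 1 - p := by linarith
  have := mul_nonneg (mul_nonneg hp hq) h
  linarith

/-- The hypothesis makes the form vanish at `w`; for a positive semidefinite matrix this forces `a
*ᵥ w = 0`. -/
theorem quadraticForm_add_eq (ha : a.PosSemidef) (y : ι → ℝ) {w : ι → ℝ}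
    (hw : ∀ k l, w k * a k l * w l = 0) :
    (a *ᵥ (y + w)) ⬝ᵥ (y + w) = (a *ᵥ y) ⬝ᵥ y := by
  have h0 : a *ᵥ w = 0 := by
    refine (ha.dotProduct_mulVec_zero_iff w).1 ?_
    simp only [star_trivial, dotProduct, Matrix.mulVec, Finset.mul_sum]
    refine Finset.sum_eq_zero fun k _ => Finset.sum_eq_zero fun l _ => ?_
    rw [← mul_assoc, hw]
  have hsymm : aᵀ = a := by simpa using ha.isHermitian.eq
  have h1 : (a *ᵥ y) ⬝ᵥ w = 0 := by
    rw [dotProduct_comm, Matrix.dotProduct_mulVec, ← Matrix.mulVec_transpose, hsymm, h0,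
      zero_dotProduct]
  rw [Matrix.mulVec_add, h0, add_zero, dotProduct_add, h1, add_zero]

end Quadratic

/-! ### Lévy–Khintchine exponents: integrability, convexity, lower bound, monotonicity -/

section LevyKhintchine

variable {h : Vec m n → Vec m n} {ν : Measure (Vec m n)}

/-- The jumps of norm at least `1` in the state space. -/
def largeJumps (m n : ℕ) : Set (Vec m n) := {ξ | ξ ∈ stateSpace m n ∧ 1 ≤ ‖ξ‖}

theorem measurableSet_largeJumps : MeasurableSet (largeJumps m n) :=
  measurableSet_stateSpace.inter (measurableSet_le measurable_const measurable_norm)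

/-- The set of finite exponential moments of the large jumps of `ν`. -/
def expDomain (ν : Measure (Vec m n)) : Set (Vec m n) :=
  {u | IntegrableOn (fun ξ => Real.exp (inner ℝ u ξ)) (largeJumps m n) ν}

theorem exp_inner_combo_le (x y ξ : Vec m n) {p q : ℝ} (hp : 0 ≤ p) (hq : 0 ≤ q)
    (hpq : p + q = 1) :
    Real.exp (inner ℝ (p • x + q • y) ξ)
      ≤ p * Real.exp (inner ℝ x ξ) + q * Real.exp (inner ℝ y ξ) := by
  rw [inner_add_left, real_inner_smul_left, real_inner_smul_left]
  exact convexOn_exp.2 (mem_univ _) (mem_univ _) hp hq hpq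

theorem convex_expDomain : Convex ℝ (expDomain ν) := by
  intro x hx y hy p q hp hq hpq
  refine ((hx.const_mul p).add (hy.const_mul q)).mono'
    (by fun_prop) (ae_of_all _ fun ξ => ?_)
  rw [Real.norm_eq_abs, abs_of_pos (Real.exp_pos _)]
  exact exp_inner_combo_le x y ξ hp hq hpq

theorem inner_le_of_mem_stateSpace {x y ξ : Vec m n} (hξ : ξ ∈ stateSpace m n)
    (hI : ∀ i, x (Sum.inl i) ≤ y (Sum.inl i)) (hJ : ∀ j, x (Sum.inr j) = y (Sum.inr j)) :
    inner ℝ x ξ ≤ inner ℝ y ξ := by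
  rw [inner_eq_sum, inner_eq_sum]
  refine Finset.sum_le_sum ?_
  rintro (i | j) -
  · exact mul_le_mul_of_nonneg_right (hI i) (hξ i)
  · rw [hJ]

theorem expDomain_of_le {x y : Vec m n} (hy : y ∈ expDomain ν)
    (hI : ∀ i, x (Sum.inl i) ≤ y (Sum.inl i)) (hJ : ∀ j, x (Sum.inr j) = y (Sum.inr j)) :
    x ∈ expDomain ν := by
  refine Integrable.mono' hy (by fun_prop)
    ((ae_restrict_iff' measurableSet_largeJumps).2 (ae_of_all _ fun ξ hξ => ?_))
  rw [Real.norm_eq_abs, abs_of_pos (Real.exp_pos _)]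
  exact Real.exp_le_exp.2 (inner_le_of_mem_stateSpace hξ.1 hI hJ)

/-- Lets the second moment dominate constants away from the origin. -/
theorem one_le_inv_sq_mul {δ : ℝ} (hδ : 0 < δ) (hδ1 : δ ≤ 1) {ξ : Vec m n} (hξ : δ ≤ ‖ξ‖) :
    1 ≤ (δ ^ 2)⁻¹ * (min 1 ‖ξ‖) ^ 2 := by
  calc 1 = (δ ^ 2)⁻¹ * δ ^ 2 := (inv_mul_cancel₀ (pow_pos hδ 2).ne').symm
    _ ≤ _ := by
      gcongr
      exact le_min hδ1 hξ

theorem integrable_levyKhintchine (hh : IsTruncation h) (hsupp : ∀ᵐ ξ ∂ν, ξ ∈ stateSpace m n)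
    (hsq : Integrable (fun ξ => (min 1 ‖ξ‖) ^ 2) ν) {u : Vec m n} (hu : u ∈ expDomain ν) :
    Integrable (fun ξ => Real.exp (inner ℝ u ξ) - 1 - inner ℝ u (h ξ)) ν := by
  obtain ⟨C, hC⟩ := hh.bounded
  obtain ⟨ε, hε, hhε⟩ := hh.eq_self_near_zero
  have hC0 : 0 ≤ C := (norm_nonneg _).trans (hC 0)
  have hmeas := hh.measurable
  -- Below `δ`, `h ξ = ξ`, `‖ξ‖ ≤ 1` and `|⟨u, ξ⟩| ≤ 1`, the range where `|e^x - 1 - x| ≤ x ^ 2` is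
  -- available.
  set δ := min (min ε 1) (‖u‖ + 1)⁻¹ with hδ
  have hδ0 : 0 < δ := by positivity
  have hδ1 : δ ≤ 1 := (min_le_left _ _).trans (min_le_right _ _)
  set A := ‖u‖ ^ 2 + (Real.exp ‖u‖ + 1 + ‖u‖ * C) * (δ ^ 2)⁻¹ with hA
  refine Integrable.mono' (g := fun ξ => A * (min 1 ‖ξ‖) ^ 2
    + (largeJumps m n).indicator (fun ξ => Real.exp (inner ℝ u ξ)) ξ)
    ((hsq.const_mul A).add ((integrable_indicator_iff measurableSet_largeJumps).2 hu))
    (by fun_prop) ?_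
  filter_upwards [hsupp] with ξ hξ
  have hind : 0 ≤ (largeJumps m n).indicator (fun ξ => Real.exp (inner ℝ u ξ)) ξ :=
    indicator_nonneg (fun _ _ => (Real.exp_pos _).le) _
  rw [Real.norm_eq_abs]
  rcases lt_or_ge ‖ξ‖ δ with hlt | hge
  · rw [hhε ξ (hlt.trans_le ((min_le_left _ _).trans (min_le_left _ _)))]
    have h1 : |inner ℝ u ξ| ≤ ‖u‖ * ‖ξ‖ := abs_real_inner_le_norm u ξ
    have h2 : ‖u‖ * ‖ξ‖ ≤ 1 := by
      calc ‖u‖ * ‖ξ‖ ≤ (‖u‖ + 1) * (‖u‖ + 1)⁻¹ := by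
            gcongr
            · linarith
            · exact hlt.le.trans (min_le_right _ _)
        _ = 1 := mul_inv_cancel₀ (by positivity)
    refine (Real.abs_exp_sub_one_sub_id_le (h1.trans h2)).trans ?_
    rw [min_eq_right (hlt.le.trans hδ1)]
    have h3 : (inner ℝ u ξ) ^ 2 ≤ ‖u‖ ^ 2 * ‖ξ‖ ^ 2 := by
      rw [← mul_pow, ← sq_abs]
      gcongr
    have h4 : 0 ≤ (Real.exp ‖u‖ + 1 + ‖u‖ * C) * (δ ^ 2)⁻¹ * ‖ξ‖ ^ 2 := by positivity
    rw [hA, add_mul]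
    linarith
  · have h1 := one_le_inv_sq_mul hδ0 hδ1 hge
    have h2 : |inner ℝ u (h ξ)| ≤ ‖u‖ * C :=
      (abs_real_inner_le_norm u _).trans (by gcongr; exact hC ξ)
    have h3 : Real.exp (inner ℝ u ξ) ≤ Real.exp ‖u‖
        + (largeJumps m n).indicator (fun ξ => Real.exp (inner ℝ u ξ)) ξ := by
      by_cases h1ξ : 1 ≤ ‖ξ‖
      · rw [indicator_of_mem (show ξ ∈ largeJumps m n from ⟨hξ, h1ξ⟩)]
        linarith [Real.exp_pos ‖u‖]
      · have : Real.exp (inner ℝ u ξ) ≤ Real.exp ‖u‖ := Real.exp_le_exp.2 <|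
          (real_inner_le_norm u ξ).trans <|
            mul_le_of_le_one_right (norm_nonneg u) (not_le.1 h1ξ).le
        linarith
    have h4 : (Real.exp ‖u‖ + 1 + ‖u‖ * C) ≤ A * (min 1 ‖ξ‖) ^ 2 := by
      have h5 := mul_le_mul_of_nonneg_left h1
        (show 0 ≤ Real.exp ‖u‖ + 1 + ‖u‖ * C by positivity)
      have h6 : 0 ≤ ‖u‖ ^ 2 * (min 1 ‖ξ‖) ^ 2 := by positivity
      rw [hA, add_mul]
      linarith
    have h7 := Real.exp_pos (inner ℝ u ξ)
    rw [abs_le] at h2 ⊢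
    constructor <;> linarith [Real.exp_pos ‖u‖]

theorem integrable_truncation_apply (hh : IsTruncation h)
    (hsq : Integrable (fun ξ => (min 1 ‖ξ‖) ^ 2) ν) {k : Fin m ⊕ Fin n}
    (hk : Integrable (fun ξ => min 1 |ξ k|) ν) : Integrable (fun ξ => h ξ k) ν := by
  obtain ⟨C, hC⟩ := hh.bounded
  obtain ⟨ε, hε, hhε⟩ := hh.eq_self_near_zero
  have hC0 : 0 ≤ C := (norm_nonneg _).trans (hC 0)
  have hmeas := hh.measurable
  have hδ0 : 0 < min ε 1 := by positivity
  refine Integrable.mono' (hk.add (hsq.const_mul (C * ((min ε 1) ^ 2)⁻¹))) (by fun_prop)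
    (ae_of_all _ fun ξ => ?_)
  simp only [Pi.add_apply]
  rw [Real.norm_eq_abs]
  have h0 : 0 ≤ min 1 |ξ k| := by positivity
  rcases lt_or_ge ‖ξ‖ (min ε 1) with hlt | hge
  · rw [hhε ξ (hlt.trans_le (min_le_left _ _)),
      min_eq_right (((abs_apply_le ξ k).trans hlt.le).trans (min_le_right _ _))]
    have : 0 ≤ C * ((min ε 1) ^ 2)⁻¹ * (min 1 ‖ξ‖) ^ 2 := by positivity
    linarith
  · have h1 := mul_le_mul_of_nonneg_left (one_le_inv_sq_mul hδ0 (min_le_right _ _) hge) hC0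
    have h2 := (abs_apply_le (h ξ) k).trans (hC ξ)
    linarith

variable {a : Matrix (Fin m ⊕ Fin n) (Fin m ⊕ Fin n) ℝ} {b : Vec m n}

theorem levyKhintchine_eq (hsupp : ν (stateSpace m n \ {0})ᶜ = 0) (u : Vec m n) :
    levyKhintchine h a b ν u = (a *ᵥ u.ofLp) ⬝ᵥ u.ofLp + inner ℝ b u
      + ∫ ξ, (Real.exp (inner ℝ u ξ) - 1 - inner ℝ u (h ξ)) ∂ν := by
  rw [levyKhintchine, Measure.restrict_eq_self_of_ae_mem
    (show ∀ᵐ ξ ∂ν, ξ ∈ stateSpace m n \ {0} from mem_ae_iff.2 hsupp)]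

theorem ae_mem_stateSpace (hsupp : ν (stateSpace m n \ {0})ᶜ = 0) :
    ∀ᵐ ξ ∂ν, ξ ∈ stateSpace m n := by
  filter_upwards [mem_ae_iff.2 hsupp] with ξ hξ using hξ.1

theorem convexOn_levyKhintchine (hh : IsTruncation h) (hsupp : ν (stateSpace m n \ {0})ᶜ = 0)
    (hsq : Integrable (fun ξ => (min 1 ‖ξ‖) ^ 2) ν) (ha : a.PosSemidef) :
    ConvexOn ℝ (expDomain ν) (levyKhintchine h a b ν) := by
  refine ⟨convex_expDomain, fun x hx y hy p q hp hq hpq => ?_⟩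
  have hint := fun {u} hu =>
    integrable_levyKhintchine hh (ae_mem_stateSpace hsupp) hsq (u := u) hu
  have h1 := quadraticForm_convexOn ha x.ofLp y.ofLp hp hq hpq
  have h2 : ∫ ξ, (Real.exp (inner ℝ (p • x + q • y) ξ) - 1 - inner ℝ (p • x + q • y) (h ξ)) ∂ν
      ≤ p * ∫ ξ, (Real.exp (inner ℝ x ξ) - 1 - inner ℝ x (h ξ)) ∂ν
        + q * ∫ ξ, (Real.exp (inner ℝ y ξ) - 1 - inner ℝ y (h ξ)) ∂ν := by
    rw [← integral_const_mul, ← integral_const_mul,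
      ← integral_add ((hint hx).const_mul p) ((hint hy).const_mul q)]
    refine integral_mono (hint (convex_expDomain hx hy hp hq hpq))
      (((hint hx).const_mul p).add ((hint hy).const_mul q)) fun ξ => ?_
    have := exp_inner_combo_le x y ξ hp hq hpq
    simp only
    rw [inner_add_left (p • x) (q • y) (h ξ), real_inner_smul_left, real_inner_smul_left]
    obtain rfl : q = 1 - p := by linarith
    linarith
  rw [levyKhintchine_eq hsupp, levyKhintchine_eq hsupp, levyKhintchine_eq hsupp,
    inner_add_right, real_inner_smul_right, real_inner_smul_right]
  simp only [smul_eq_mul, WithLp.ofLp_add, WithLp.ofLp_smul]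
  linarith

/-- The quadratic form is nonnegative, and so is the integrand at small jumps, since `e^x ≥ 1 + x`.
At the remaining jumps, of finite total mass, the integrand is at least `-(1 + ‖u‖ * C)`. Only
linear growth is left. -/
theorem exists_lower_bound_levyKhintchine (hh : IsTruncation h)
    (hsupp : ν (stateSpace m n \ {0})ᶜ = 0) (hsq : Integrable (fun ξ => (min 1 ‖ξ‖) ^ 2) ν)
    (ha : a.PosSemidef) :
    ∃ C, 0 ≤ C ∧ ∀ u ∈ expDomain ν, -(C * (1 + ‖u‖)) ≤ levyKhintchine h a b ν u := by
  obtain ⟨C, hC⟩ := hh.bounded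
  obtain ⟨ε, hε, hhε⟩ := hh.eq_self_near_zero
  have hC0 : 0 ≤ C := (norm_nonneg _).trans (hC 0)
  have hδ0 : 0 < min ε 1 := by positivity
  set M := ∫ ξ, (min 1 ‖ξ‖) ^ 2 ∂ν with hM
  have hM0 : 0 ≤ M := integral_nonneg fun ξ => by positivity
  set D := ((min ε 1) ^ 2)⁻¹ with hD
  have hD0 : 0 ≤ D := by positivity
  refine ⟨‖b‖ + (1 + C) * D * M, by positivity, fun u hu => ?_⟩
  have h1 : 0 ≤ (a *ᵥ u.ofLp) ⬝ᵥ u.ofLp := by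
    rw [dotProduct_comm]
    simpa using ha.dotProduct_mulVec_nonneg u.ofLp
  have h2 := (abs_le.1 (abs_real_inner_le_norm b u)).1
  have h3 : -((1 + ‖u‖ * C) * D * M)
      ≤ ∫ ξ, (Real.exp (inner ℝ u ξ) - 1 - inner ℝ u (h ξ)) ∂ν := by
    rw [hM, ← integral_const_mul, ← integral_neg]
    refine integral_mono (hsq.const_mul _).neg
      (integrable_levyKhintchine hh (ae_mem_stateSpace hsupp) hsq hu) fun ξ => ?_
    simp only
    rcases lt_or_ge ‖ξ‖ (min ε 1) with hlt | hge
    · rw [hhε ξ (hlt.trans_le (min_le_left _ _))]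
      have h4 := Real.add_one_le_exp (inner ℝ u ξ)
      have h5 : 0 ≤ (1 + ‖u‖ * C) * D * (min 1 ‖ξ‖) ^ 2 := by positivity
      linarith
    · have h4 := mul_le_mul_of_nonneg_left (one_le_inv_sq_mul hδ0 (min_le_right _ _) hge)
        (show 0 ≤ 1 + ‖u‖ * C by positivity)
      have h5 : inner ℝ u (h ξ) ≤ ‖u‖ * C :=
        (real_inner_le_norm u _).trans (by gcongr; exact hC ξ)
      have h6 := Real.exp_pos (inner ℝ u ξ)
      linarith
  have h7 : 0 ≤ D * M := by positivity
  have h8 := norm_nonneg u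
  have h9 := norm_nonneg b
  rw [levyKhintchine_eq hsupp]
  nlinarith [mul_nonneg h7 h8, mul_nonneg hC0 h7]

/-- Quasi-monotonicity of the characteristic exponent in the coordinates of `I` other than `i`. -/
theorem levyKhintchine_le (hh : IsTruncation h) (hsupp : ν (stateSpace m n \ {0})ᶜ = 0)
    (hsq : Integrable (fun ξ => (min 1 ‖ξ‖) ^ 2) ν) (ha : a.PosSemidef) {i : Fin m}
    (haI : ∀ k l : Fin m, ¬(k = i ∧ l = i) → a (Sum.inl k) (Sum.inl l) = 0)
    (hint : ∀ k : Fin m, k ≠ i → Integrable (fun ξ => h ξ (Sum.inl k)) ν)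
    (hb : ∀ k : Fin m, k ≠ i → 0 ≤ b (Sum.inl k) - ∫ ξ, h ξ (Sum.inl k) ∂ν)
    {x y : Vec m n} (hy : y ∈ expDomain ν) (hI : ∀ k, x (Sum.inl k) ≤ y (Sum.inl k))
    (hJ : ∀ j, x (Sum.inr j) = y (Sum.inr j)) (hi : x (Sum.inl i) = y (Sum.inl i)) :
    levyKhintchine h a b ν x ≤ levyKhintchine h a b ν y := by
  have hx := expDomain_of_le hy hI hJ
  have hsupp' := ae_mem_stateSpace hsupp
  obtain ⟨w, rfl⟩ : ∃ w, y = x + w := ⟨y - x, by abel⟩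
  have hwI : ∀ k, 0 ≤ w (Sum.inl k) := fun k => by simpa using hI k
  have hwJ : ∀ j, w (Sum.inr j) = 0 := fun j => by simpa using hJ j
  have hwi : w (Sum.inl i) = 0 := by simpa using hi
  -- `w` is supported on `I ∖ {i}`, where the block of `a` vanishes.
  have hquad : (a *ᵥ (x + w).ofLp) ⬝ᵥ (x + w).ofLp = (a *ᵥ x.ofLp) ⬝ᵥ x.ofLp := by
    rw [WithLp.ofLp_add]
    refine quadraticForm_add_eq ha x.ofLp (w := w.ofLp) ?_
    rintro (k | k) (l | l)
    · by_cases hkl : k = i ∧ l = i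
      · rw [hkl.1, hwi, zero_mul, zero_mul]
      · rw [haI k l hkl, mul_zero, zero_mul]
    all_goals simp [hwJ]
  have hterm : ∀ k, Integrable (fun ξ => w k * h ξ k) ν ∧
      w k * ∫ ξ, h ξ k ∂ν ≤ b k * w k := by
    rintro (k | j)
    · by_cases hk : k = i
      · subst hk
        simp [hwi]
      · refine ⟨(hint k hk).const_mul _, ?_⟩
        rw [mul_comm]
        exact mul_le_mul_of_nonneg_right (sub_nonneg.1 (hb k hk)) (hwI k)
    · simp [hwJ]
  have hwh : Integrable (fun ξ => inner ℝ w (h ξ)) ν := by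
    simp only [inner_eq_sum]
    exact integrable_finsetSum _ fun k _ => (hterm k).1
  -- Inward drift enters here: the drift along `w ≥ 0` outweighs the compensator that `w` adds.
  have hbw : ∫ ξ, inner ℝ w (h ξ) ∂ν ≤ inner ℝ b w := by
    simp only [inner_eq_sum]
    rw [integral_finsetSum _ fun k _ => (hterm k).1]
    refine Finset.sum_le_sum fun k _ => ?_
    rw [integral_const_mul]
    exact (hterm k).2
  have hmono : ∫ ξ, (Real.exp (inner ℝ x ξ) - 1 - inner ℝ x (h ξ)) ∂ν
      ≤ ∫ ξ, (Real.exp (inner ℝ (x + w) ξ) - 1 - inner ℝ (x + w) (h ξ)) ∂ν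
        + ∫ ξ, inner ℝ w (h ξ) ∂ν := by
    rw [← integral_add (integrable_levyKhintchine hh hsupp' hsq hy) hwh]
    refine integral_mono_ae (integrable_levyKhintchine hh hsupp' hsq hx)
      ((integrable_levyKhintchine hh hsupp' hsq hy).add hwh) ?_
    filter_upwards [hsupp'] with ξ hξ
    have := Real.exp_le_exp.2 (inner_le_of_mem_stateSpace hξ hI hJ)
    rw [inner_add_left x w (h ξ)]
    linarith
  rw [levyKhintchine_eq hsupp, levyKhintchine_eq hsupp, hquad, inner_add_right]
  linarith

end LevyKhintchine

/-! ### Consequences of admissibility for `𝒴`, `F` and `R` -/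

theorem sq_min_one_norm_le (ξ : Vec m n) : (min 1 ‖ξ‖) ^ 2 ≤ ∑ k, (min 1 |ξ k|) ^ 2 := by
  by_cases h : ∀ k, |ξ k| ≤ 1
  · calc (min 1 ‖ξ‖) ^ 2 ≤ ‖ξ‖ ^ 2 := by gcongr; exact min_le_right _ _
      _ = ∑ k, (min 1 |ξ k|) ^ 2 := by
        rw [EuclideanSpace.norm_sq_eq]
        exact Finset.sum_congr rfl fun k _ => by rw [min_eq_right (h k), Real.norm_eq_abs]
  · push Not at h
    obtain ⟨k, hk⟩ := h
    calc (min 1 ‖ξ‖) ^ 2 ≤ 1 ^ 2 := by gcongr; exact min_le_left _ _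
      _ = (min 1 |ξ k|) ^ 2 := by rw [min_eq_left hk.le]
      _ ≤ _ := Finset.single_le_sum (f := fun k => (min 1 |ξ k|) ^ 2)
        (fun _ _ => sq_nonneg _) (Finset.mem_univ k)

theorem sq_min_one_le (x : ℝ) : (min 1 |x|) ^ 2 ≤ min 1 |x| :=
  pow_le_of_le_one (by positivity) (min_le_left _ _) two_ne_zero

theorem integrable_of_le_of_lintegral_lt_top {ν : Measure (Vec m n)} {f g : Vec m n → ℝ}
    (hg : Measurable g) (hν : ∫⁻ ξ, ENNReal.ofReal (g ξ) ∂ν < ⊤) (hf : Measurable f)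
    (hf0 : ∀ ξ, 0 ≤ f ξ) (hfg : ∀ ξ, f ξ ≤ g ξ) : Integrable f ν := by
  have hg' : Integrable g ν := (lintegral_ofReal_ne_top_iff_integrable hg.aestronglyMeasurable
    (ae_of_all _ fun ξ => (hf0 ξ).trans (hfg ξ))).1 hν.ne
  refine hg'.mono' hf.aestronglyMeasurable (ae_of_all _ fun ξ => ?_)
  rw [Real.norm_eq_abs, abs_of_nonneg (hf0 ξ)]
  exact hfg ξ

namespace Params

variable {P : Params m n}

theorem IsAdmissible.integrable_sq₀ (hP : P.IsAdmissible) :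
    Integrable (fun ξ => (min 1 ‖ξ‖) ^ 2) P.μ₀ := by
  refine integrable_of_le_of_lintegral_lt_top (by fun_prop) hP.μ₀_moment (by fun_prop)
    (fun ξ => by positivity) fun ξ => (sq_min_one_norm_le ξ).trans ?_
  rw [Fintype.sum_sum_type]
  gcongr
  exact sq_min_one_le _

theorem IsAdmissible.integrable_sq (hP : P.IsAdmissible) (i : Fin m) :
    Integrable (fun ξ => (min 1 ‖ξ‖) ^ 2) (P.μ (Sum.inl i)) := by
  refine integrable_of_le_of_lintegral_lt_top (by fun_prop) (hP.μ_moment i) (by fun_prop)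
    (fun ξ => by positivity) fun ξ => (sq_min_one_norm_le ξ).trans ?_
  rw [Fintype.sum_sum_type, ← Finset.sum_erase_add _ _ (Finset.mem_univ i)]
  gcongr
  exact sq_min_one_le _

theorem IsAdmissible.integrable_min (hP : P.IsAdmissible) {i k : Fin m} (hk : k ≠ i) :
    Integrable (fun ξ : Vec m n => min 1 |ξ (Sum.inl k)|) (P.μ (Sum.inl i)) := by
  refine integrable_of_le_of_lintegral_lt_top (by fun_prop) (hP.μ_moment i) (by fun_prop)
    (fun ξ => by positivity) fun ξ => ?_
  have h1 : min 1 |ξ (Sum.inl k)| ≤ ∑ k ∈ Finset.univ.erase i, min 1 |ξ (Sum.inl k)| :=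
    Finset.single_le_sum (f := fun k => min 1 |ξ (Sum.inl k)|) (fun _ _ => by positivity)
      (Finset.mem_erase.2 ⟨hk, Finset.mem_univ k⟩)
  have h2 : 0 ≤ ∑ j : Fin n, (min 1 |ξ (Sum.inr j)|) ^ 2 := by positivity
  have h3 := sq_nonneg (min 1 |ξ (Sum.inl i)|)
  linarith

theorem mem_Y_iff {y : Vec m n} :
    y ∈ P.Y ↔ y ∈ expDomain P.μ₀ ∧ ∀ i : Fin m, y ∈ expDomain (P.μ (Sum.inl i)) := by
  have h : ∀ ν : Measure (Vec m n), y ∈ expDomain ν ↔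
      ∫⁻ ξ in largeJumps m n, ENNReal.ofReal (Real.exp (inner ℝ y ξ)) ∂ν < ⊤ := fun ν =>
    (lintegral_ofReal_ne_top_iff_integrable (by fun_prop)
      (ae_of_all _ fun ξ => (Real.exp_pos _).le)).symm.trans lt_top_iff_ne_top.symm
  simp only [h, Y, mem_ofPred_eq, ENNReal.add_lt_top, ENNReal.sum_lt_top, Finset.mem_univ,
    true_imp_iff]
  rfl

theorem convex_Y : Convex ℝ P.Y := fun _ hx _ hy _ _ hp hq hpq => mem_Y_iff.2
  ⟨convex_expDomain (mem_Y_iff.1 hx).1 (mem_Y_iff.1 hy).1 hp hq hpq, fun i =>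
    convex_expDomain ((mem_Y_iff.1 hx).2 i) ((mem_Y_iff.1 hy).2 i) hp hq hpq⟩

/-- The translate of `interior P.Y` by `x - y` is open, contains `x`, and lies in `P.Y` because
`P.Y` is stable under lowering coordinates in `I`. -/
theorem mem_interior_Y_of_le {x y : Vec m n} (hy : y ∈ interior P.Y)
    (hI : ∀ i, x (Sum.inl i) ≤ y (Sum.inl i)) (hJ : ∀ j, x (Sum.inr j) = y (Sum.inr j)) :
    x ∈ interior P.Y := by
  have hsub : (fun p => p + (y - x)) ⁻¹' interior P.Y ⊆ P.Y := by
    intro p hp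
    have hp' := mem_Y_iff.1 (interior_subset hp)
    have hpI : ∀ i, p (Sum.inl i) ≤ (p + (y - x)) (Sum.inl i) := fun i => by simpa using hI i
    have hpJ : ∀ j, p (Sum.inr j) = (p + (y - x)) (Sum.inr j) := fun j => by simp [hJ j]
    exact mem_Y_iff.2 ⟨expDomain_of_le hp'.1 hpI hpJ, fun i =>
      expDomain_of_le (hp'.2 i) hpI hpJ⟩
  refine interior_maximal hsub (isOpen_interior.preimage (by fun_prop)) ?_
  simpa using hy

theorem IsAdmissible.convexOn_F (hP : P.IsAdmissible) : ConvexOn ℝ P.Y P.F :=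
  (convexOn_levyKhintchine hP.truncation hP.μ₀_supp hP.integrable_sq₀ hP.α₀_psd).subset
    (fun _ hy => (mem_Y_iff.1 hy).1) convex_Y

theorem IsAdmissible.convexOn_R_inl (hP : P.IsAdmissible) (i : Fin m) :
    ConvexOn ℝ P.Y fun u => P.R u (Sum.inl i) :=
  (convexOn_levyKhintchine hP.truncation (hP.μ_supp _) (hP.integrable_sq i) (hP.α_psd i)).subset
    (fun _ hy => (mem_Y_iff.1 hy).2 i) convex_Y

theorem IsAdmissible.R_inr (hP : P.IsAdmissible) (u : Vec m n) (j : Fin n) :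
    P.R u (Sum.inr j) = inner ℝ (P.β (Sum.inr j)) u := by
  simp [R, levyKhintchine, hP.α_J, hP.μ_J]

theorem IsAdmissible.R_inr_congr (hP : P.IsAdmissible) {x y : Vec m n}
    (h : ∀ j, x (Sum.inr j) = y (Sum.inr j)) (j : Fin n) :
    P.R x (Sum.inr j) = P.R y (Sum.inr j) := by
  rw [hP.R_inr, hP.R_inr, inner_eq_sum, inner_eq_sum]
  simp [hP.β_J, h]

theorem IsAdmissible.convexOn_R (hP : P.IsAdmissible) (k : Fin m ⊕ Fin n) :
    ConvexOn ℝ P.Y fun u => P.R u k := by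
  rcases k with i | j
  · exact hP.convexOn_R_inl i
  · refine ⟨convex_Y, fun x _ y _ p q _ _ _ => le_of_eq ?_⟩
    simp [hP.R_inr, inner_add_right, real_inner_smul_right]

theorem IsAdmissible.R_inl_le (hP : P.IsAdmissible) {x y : Vec m n} (hy : y ∈ P.Y)
    (hI : ∀ i, x (Sum.inl i) ≤ y (Sum.inl i)) (hJ : ∀ j, x (Sum.inr j) = y (Sum.inr j))
    {i : Fin m} (hi : x (Sum.inl i) = y (Sum.inl i)) :
    P.R x (Sum.inl i) ≤ P.R y (Sum.inl i) :=
  levyKhintchine_le hP.truncation (hP.μ_supp _) (hP.integrable_sq i) (hP.α_psd i)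
    (hP.α_II i) (fun _ hk => integrable_truncation_apply hP.truncation (hP.integrable_sq i)
      (hP.integrable_min hk)) (fun k hk => hP.β_I i k hk) ((mem_Y_iff.1 hy).2 i) hI hJ hi

theorem IsAdmissible.exists_lower_bound_R (hP : P.IsAdmissible) :
    ∃ C, 0 ≤ C ∧ ∀ y ∈ P.Y, ∀ i : Fin m, -(C * (1 + ‖y‖)) ≤ P.R y (Sum.inl i) := by
  choose C hC0 hC using fun i => exists_lower_bound_levyKhintchine (b := P.β (Sum.inl i))
    hP.truncation (hP.μ_supp _) (hP.integrable_sq i) (hP.α_psd i)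
  refine ⟨∑ i, C i, Finset.sum_nonneg fun i _ => hC0 i, fun y hy i => ?_⟩
  refine le_trans (neg_le_neg ?_) (hC i y ((mem_Y_iff.1 hy).2 i))
  gcongr
  exact Finset.single_le_sum (fun i _ => hC0 i) (Finset.mem_univ i)

/-- Finite convex functions in finite dimension are locally Lipschitz in the interior of their
domain, so no derivative of the integral is needed. -/
theorem IsAdmissible.locallyLipschitzOn_field (hP : P.IsAdmissible) (c : Vec m n)
    (k : Fin m ⊕ Fin n) : LocallyLipschitzOn (interior P.Y) fun y => (P.R y + c) k :=
  ((hP.convexOn_R k).add_const (c k)).locallyLipschitzOn_interior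

end Params

/-! ### Riccati solutions and their convex combinations -/

variable {P : Params m n} {Λ : Vec m n}

theorem IsRiccatiSolution.mono {u : Vec m n} {v T T' : ℝ} {φ : ℝ → ℝ} {ψ : ℝ → Vec m n}
    (H : IsRiccatiSolution P Λ u v T φ ψ) (hT : T' ≤ T) :
    IsRiccatiSolution P Λ u v T' φ ψ := by
  have hsub : Icc 0 T' ⊆ Icc 0 T := Icc_subset_Icc_right hT
  exact ⟨H.φ_zero, H.ψ_zero, fun t ht => H.mem_interior t (hsub ht),
    fun t ht => (H.φ_deriv t (hsub ht)).mono hsub, fun t ht => (H.ψ_deriv t (hsub ht)).mono hsub⟩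

theorem IsRiccatiSolution.eqOn (hP : P.IsAdmissible) {u : Vec m n} {v T : ℝ} {φ φ' : ℝ → ℝ}
    {ψ ψ' : ℝ → Vec m n} (H : IsRiccatiSolution P Λ u v T φ ψ)
    (H' : IsRiccatiSolution P Λ u v T φ' ψ') : EqOn ψ ψ' (Icc 0 T) :=
  eqOn_of_hasDerivWithinAt (hP.locallyLipschitzOn_field (v • Λ)) H.mem_interior H'.mem_interior
    H.ψ_deriv H'.ψ_deriv (H.ψ_zero.trans H'.ψ_zero.symm)

/-- `Psi` picks a solution by choice, separately for each `s`; uniqueness makes the pick irrelevant.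
-/
theorem IsRiccatiSolution.psi_eq (hP : P.IsAdmissible) {u : Vec m n} {v s : ℝ} (hs : 0 ≤ s)
    {φ : ℝ → ℝ} {ψ : ℝ → Vec m n} (H : IsRiccatiSolution P Λ u v s φ ψ) :
    Psi P Λ s u v = ψ s := by
  have hex : ∃ p : (ℝ → ℝ) × (ℝ → Vec m n), IsRiccatiSolution P Λ u v s p.1 p.2 := ⟨(φ, ψ), H⟩
  rw [Psi, dif_pos hex]
  exact hex.choose_spec.eqOn hP H (right_mem_Icc.2 hs)

theorem exists_isRiccatiSolution_of_mem_Yt {u : Vec m n} {v t : ℝ} (ht : 0 ≤ t)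
    (h : (u, v) ∈ Yt P Λ t) : ∃ T, t < T ∧ ∃ φ ψ, IsRiccatiSolution P Λ u v T φ ψ := by
  obtain ⟨_, ⟨T, -, rfl, hφψ⟩, hlt⟩ := lt_sSup_iff.1 h.2
  exact ⟨T, (ENNReal.ofReal_lt_ofReal_iff_of_nonneg ht).1 hlt, hφψ⟩

theorem IsRiccatiSolution.exists_convexComb (hP : P.IsAdmissible) {T : ℝ} (hT : 0 ≤ T)
    {u₁ u₂ : Vec m n} {v₁ v₂ : ℝ} {φ₁ φ₂ : ℝ → ℝ} {ψ₁ ψ₂ : ℝ → Vec m n}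
    (H₁ : IsRiccatiSolution P Λ u₁ v₁ T φ₁ ψ₁) (H₂ : IsRiccatiSolution P Λ u₂ v₂ T φ₂ ψ₂)
    {p q : ℝ} (hp : 0 ≤ p) (hq : 0 ≤ q) (hpq : p + q = 1) :
    ∃ φ ψ, IsRiccatiSolution P Λ (p • u₁ + q • u₂) (p * v₁ + q * v₂) T φ ψ ∧
      ∀ t ∈ Icc 0 T, ∀ i : Fin m,
        ψ t (Sum.inl i) ≤ p * ψ₁ t (Sum.inl i) + q * ψ₂ t (Sum.inl i) := by
  set c : Vec m n := (p * v₁ + q * v₂) • Λ with hc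
  obtain ⟨C, hC0, hC⟩ := hP.exists_lower_bound_R
  have hmem : ∀ t ∈ Icc 0 T, p • ψ₁ t + q • ψ₂ t ∈ interior P.Y := fun t ht =>
    Params.convex_Y.interior (H₁.mem_interior t ht) (H₂.mem_interior t ht) hp hq hpq
  obtain ⟨ψ, hψ0, hψ⟩ := exists_solution_le_supersolution (U := interior P.Y)
    (G := fun y => P.R y + c) (C := C + ‖c‖) (z := fun t => p • ψ₁ t + q • ψ₂ t)
    (z' := fun t => p • (P.R (ψ₁ t) + v₁ • Λ) + q • (P.R (ψ₂ t) + v₂ • Λ))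
    (fun y hy x hI hJ => Params.mem_interior_Y_of_le hy hI hJ) (hP.locallyLipschitzOn_field c)
    (fun y hy x hI hJ i hi => by
      simpa using hP.R_inl_le (interior_subset hy) hI hJ hi)
    (fun x y h j => by simpa using hP.R_inr_congr h j) (by positivity)
    -- Adding the constant `c` costs at most `‖c‖`, whence the constant `C + ‖c‖`.
    (fun y hy i => by
      have h1 := hC y (interior_subset hy) i
      have h2 := (abs_le.1 (abs_apply_le c (Sum.inl i))).1
      have h3 := mul_nonneg (norm_nonneg c) (norm_nonneg y)
      simp only [PiLp.add_apply]
      linarith)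
    hT hmem (fun t ht => ((H₁.ψ_deriv t ht).const_smul p).add ((H₂.ψ_deriv t ht).const_smul q))
    (fun t ht i => by
      have h := (hP.convexOn_R (Sum.inl i)).2 (interior_subset (H₁.mem_interior t ht))
        (interior_subset (H₂.mem_interior t ht)) hp hq hpq
      simp only [hc, PiLp.add_apply, PiLp.smul_apply, smul_eq_mul] at h ⊢
      linarith)
    (fun t ht j => by
      simp only [hc, PiLp.add_apply, PiLp.smul_apply, smul_eq_mul, hP.R_inr, inner_add_right,
        real_inner_smul_right]
      ring)
  have hψc : ContinuousOn ψ (Icc 0 T) := fun t ht => (hψ t ht).2.1.continuousWithinAt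
  have hFc : ContinuousOn (fun t => P.F (ψ t)) (Icc 0 T) :=
    hP.convexOn_F.continuousOn_interior.comp hψc fun t ht => (hψ t ht).1
  refine ⟨fun t => ∫ s in (0 : ℝ)..t, P.F (ψ s), ψ, ⟨by simp, ?_, fun t ht => (hψ t ht).1,
    fun t ht => ?_, fun t ht => (hψ t ht).2.1⟩, fun t ht i => by simpa using (hψ t ht).2.2.1 i⟩
  · rw [hψ0, H₁.ψ_zero, H₂.ψ_zero]
  -- The fundamental theorem of calculus within `Icc 0 T` takes the membership as an instance.
  · have : Fact (t ∈ Icc 0 T) := ⟨ht⟩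
    exact intervalIntegral.integral_hasDerivWithinAt_right
      ((hFc.mono (by rw [uIcc_of_le ht.1]; exact Icc_subset_Icc_right ht.2)).intervalIntegrable)
      (hFc.stronglyMeasurableAtFilter_nhdsWithin measurableSet_Icc t) (hFc t ht)

end AffineRiccati

theorem lemma2p5 {m n : ℕ} (P : AffineRiccati.Params m n) (hP : P.IsAdmissible)
    (Λ : AffineRiccati.Vec m n) (t : ℝ) (ht : 0 ≤ t)
    (u₁ u₂ : AffineRiccati.Vec m n) (v₁ v₂ : ℝ)
    (h₁ : (u₁, v₁) ∈ AffineRiccati.Yt P Λ t) (h₂ : (u₂, v₂) ∈ AffineRiccati.Yt P Λ t)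
    (lam : ℝ) (hlam : lam ∈ Set.Icc (0 : ℝ) 1) :
    (lam • u₁ + (1 - lam) • u₂, lam * v₁ + (1 - lam) * v₂) ∈ AffineRiccati.Yt P Λ t ∧
    ∀ s ∈ Set.Icc (0 : ℝ) t,
      AffineRiccati.PsiI P Λ s (lam • u₁ + (1 - lam) • u₂) (lam * v₁ + (1 - lam) * v₂) ≤
        lam • AffineRiccati.PsiI P Λ s u₁ v₁ + (1 - lam) • AffineRiccati.PsiI P Λ s u₂ v₂ := by
  have hlam' : 0 ≤ 1 - lam := sub_nonneg.2 hlam.2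
  have hsum : lam + (1 - lam) = 1 := by ring
  obtain ⟨T₁, hT₁, φ₁, ψ₁, H₁⟩ := AffineRiccati.exists_isRiccatiSolution_of_mem_Yt ht h₁
  obtain ⟨T₂, hT₂, φ₂, ψ₂, H₂⟩ := AffineRiccati.exists_isRiccatiSolution_of_mem_Yt ht h₂
  -- Solving up to a time strictly beyond `t` is what makes the lifetime strictly larger than `t`.
  have hT : t < min T₁ T₂ := lt_min hT₁ hT₂
  obtain ⟨φ, ψ, H, hle⟩ := (H₁.mono (min_le_left T₁ T₂)).exists_convexComb hP (ht.trans hT.le)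
    (H₂.mono (min_le_right T₁ T₂)) hlam.1 hlam' hsum
  refine ⟨⟨AffineRiccati.Params.convex_Y.interior h₁.1 h₂.1 hlam.1 hlam' hsum, ?_⟩, ?_⟩
  · refine lt_of_lt_of_le ((ENNReal.ofReal_lt_ofReal_iff_of_nonneg ht).2 hT) ?_
    exact le_sSup ⟨_, ht.trans hT.le, rfl, φ, ψ, H⟩
  · intro s hs i
    have hsT : s ≤ min T₁ T₂ := hs.2.trans hT.le
    simp only [AffineRiccati.PsiI, Pi.add_apply, Pi.smul_apply, smul_eq_mul]
    rw [(H.mono hsT).psi_eq hP hs.1, (H₁.mono (hsT.trans (min_le_left _ _))).psi_eq hP hs.1,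
      (H₂.mono (hsT.trans (min_le_right _ _))).psi_eq hP hs.1]
    exact hle s ⟨hs.1, hsT⟩ i
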